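/- Let $L/K$ be a finite extension of number fields with rings of integers $O_K\subseteq O_L$. Let $P_K$ be the set of nonzero prime ideals of $O_K$ and $I_K$ the monoid of nonzero ideals of $O_K$ under multiplication. For $\mathfrak p\in P_K$ write $q_{\mathfrak p}=\#(O_K/\mathfrak p)$, and for $\mathfrak a\in I_K$ let $\psi_{\mathfrak a}$ be the shift $(\xi_{\mathfrak b})_{\mathfrak b}\mapsto(\xi_{\mathfrak a\mathfrak b})_{\mathfrak b}$ on the $O_K$-algebra $O_L^{I_K}$ (with componentwise operations). Put $U_0=O_L^{I_K}$, $$U_{n+1}=\{\xi\in U_n \mid \psi_{\mathfrak p}\xi-\xi^{q_{\mathfrak p}}\in\mathfrak p\,U_n\ \text{for all}\ \mathfrak p\in P_K\}\quad(n\ge 0),$$ and let $W_{O_K}(O_L)=\bigcap_{n\ge0}U_n$ be the ring of Witt vectors; it is an $O_K$-subalgebra of $O_L^{I_K}$ stable under all $\psi_{\mathfrak a}$. A Witt vector $\xi=(\xi_{\mathfrak a})_{\mathfrak a\in I_K}\in W_{O_K}(O_L)$ is called automatic if there are a finite set $S$, a transition function $\delta:S\times P_K\to S$, an initial state $s_0\in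 S$ and an output function $\tau:S\to O_L$ (a deterministic finite automaton with output, with input alphabet $P_K$) such that for every finite word $\mathfrak p_1\mathfrak p_2\cdots\mathfrak p_r$ over $P_K$ ($r\ge 0$), reading the word letter by letter from left to right starting at $s_0$ ends in a state $s$ with $\tau(s)=\xi_{\mathfrak a}$, where $\mathfrak a=\mathfrak p_1\mathfrak p_2\cdots\mathfrak p_r\in I_K$ is the product (and $\mathfrak a=O_K$ for the empty word). Theorem. For every $\xi\in W_{O_K}(O_L)$ the following four conditions are equivalent: 1. $\xi$ is integral over $O_K$; 2. the set of coefficient values $\{\xi_{\mathfrak a}\mid\mathfrak a\in I_K\}\subseteq O_L$ is finite; 3. the orbit $\{\psi_{\mathfrak a}\xi\mid\mathfrak a\in I_K\}\subseteq W_{O_K}(O_L)$ is finite; 4. $\xi$ is automatic. -/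

import Mathlib

open scoped nonZeroDivisors NumberField
open IsDedekindDomain

noncomputable section

namespace ArithChristol

/-! ### Ideals, primes, and shifts

For a Dedekind domain `R`, `P_K` is `HeightOneSpectrum R` (the nonzero primes) and `I_K` is the
multiplicative monoid `(Ideal R)⁰` of nonzero ideals. -/

section Witt

variable (R : Type*) [CommRing R]

/-- The monoid `I_K` of nonzero ideals of `R`. -/
abbrev NonzeroIdeal : Type _ := (Ideal R)⁰

variable {R}

/-- A nonzero prime, seen as an element of the monoid of nonzero ideals. -/
def primeIdeal [IsDedekindDomain R] (p : HeightOneSpectrum R) : NonzeroIdeal R :=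
  ⟨p.asIdeal, mem_nonZeroDivisors_of_ne_zero p.ne_bot⟩

/-- The cardinality of the residue field `R / 𝔭`. -/
def residueCard (p : HeightOneSpectrum R) : ℕ := Nat.card (R ⧸ p.asIdeal)

variable (A : Type*) [CommRing A] [Algebra R A]

/-- The shift `(ξ_𝔟)_𝔟 ↦ (ξ_{𝔞𝔟})_𝔟` on the product algebra `A^{I_K}`. -/
def shift (a : NonzeroIdeal R) : (NonzeroIdeal R → A) →ₐ[R] (NonzeroIdeal R → A) where
  toFun ξ := fun b => ξ (a * b)
  map_one' := rfl
  map_mul' _ _ := rfl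
  map_zero' := rfl
  map_add' _ _ := rfl
  commutes' _ := rfl

variable {A}

@[simp] lemma shift_apply (a b : NonzeroIdeal R) (ξ : NonzeroIdeal R → A) :
    shift A a ξ b = ξ (a * b) := rfl

lemma shift_one (ξ : NonzeroIdeal R → A) : shift A 1 ξ = ξ := by
  ext b; simp

/-- Shifts compose multiplicatively: the shift by `𝔭₁ ⋯ 𝔭ₙ` is the composite of the shifts by
the `𝔭ᵢ`. -/
lemma shift_mul (a b : NonzeroIdeal R) (ξ : NonzeroIdeal R → A) :
    shift A (a * b) ξ = shift A a (shift A b ξ) := by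
  ext c
  simp only [shift_apply]
  congr 1
  rw [mul_left_comm, mul_assoc]

lemma smul_mul_mem (U : Subalgebra R (NonzeroIdeal R → A)) (I : Ideal R)
    {x y : NonzeroIdeal R → A} (hx : x ∈ I • U.toSubmodule) (hy : y ∈ U) :
    x * y ∈ I • U.toSubmodule := by
  refine Submodule.smul_induction_on hx (fun r hr n hn => ?_) (fun u v hu hv => ?_)
  · rw [smul_mul_assoc]
    exact Submodule.smul_mem_smul hr (U.mul_mem hn hy)
  · rw [add_mul]
    exact Submodule.add_mem _ hu hv

lemma smul_toSubmodule_le (U : Subalgebra R (NonzeroIdeal R → A)) (I : Ideal R)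
    {x : NonzeroIdeal R → A} (hx : x ∈ I • U.toSubmodule) : x ∈ U :=
  Submodule.smul_le_right (I := I) (N := U.toSubmodule) hx

variable [IsDedekindDomain R] [Ring.HasFiniteQuotients R]

lemma residueCard_eq (p : HeightOneSpectrum R) :
    ∃ ℓ n : ℕ, ℓ.Prime ∧ residueCard p = ℓ ^ n ∧ (ℓ : R) ∈ p.asIdeal := by
  have : Finite (R ⧸ p.asIdeal) := Ring.HasFiniteQuotients.finiteQuotient p.ne_bot
  have : p.asIdeal.IsMaximal := p.isMaximal
  let _ : Field (R ⧸ p.asIdeal) := Ideal.Quotient.field _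
  let _ := Fintype.ofFinite (R ⧸ p.asIdeal)
  obtain ⟨ℓ, hc, n, hp, hn⟩ := FiniteField.card' (R ⧸ p.asIdeal)
  refine ⟨ℓ, n, hp, by rw [residueCard, Nat.card_eq_fintype_card, hn], ?_⟩
  rw [← Ideal.Quotient.eq_zero_iff_mem, map_natCast]
  exact CharP.cast_eq_zero _ _

lemma sub_pow_residueCard_mem (p : HeightOneSpectrum R) (r : R) :
    r - r ^ residueCard p ∈ p.asIdeal := by
  have : Finite (R ⧸ p.asIdeal) := Ring.HasFiniteQuotients.finiteQuotient p.ne_bot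
  have : p.asIdeal.IsMaximal := p.isMaximal
  let _ : Field (R ⧸ p.asIdeal) := Ideal.Quotient.field _
  let _ := Fintype.ofFinite (R ⧸ p.asIdeal)
  rw [← Ideal.Quotient.eq_zero_iff_mem, map_sub, map_pow, residueCard,
    Nat.card_eq_fintype_card, FiniteField.pow_card, sub_self]

/-- One step of the inductive construction of Witt vectors: from `U ⊆ A^{I_K}` to
`{ξ ∈ U | ∀ 𝔭, ψ_𝔭 ξ - ξ^{#k_𝔭} ∈ 𝔭 U}`, which is again a subalgebra. -/
def wittStep (U : Subalgebra R (NonzeroIdeal R → A)) : Subalgebra R (NonzeroIdeal R → A) where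
  carrier := {ξ | ξ ∈ U ∧ ∀ p : HeightOneSpectrum R,
    shift A (primeIdeal p) ξ - ξ ^ residueCard p ∈ p.asIdeal • U.toSubmodule}
  mul_mem' := by
    rintro x y ⟨hx, hx'⟩ ⟨hy, hy'⟩
    refine ⟨U.mul_mem hx hy, fun p => ?_⟩
    have hs : shift A (primeIdeal p) y ∈ U := by
      have := U.add_mem (smul_toSubmodule_le U _ (hy' p)) (U.pow_mem hy (residueCard p))
      simpa using this
    have h1 := smul_mul_mem U _ (hx' p) hs
    have h2 := smul_mul_mem U _ (hy' p) (U.pow_mem hx (residueCard p))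
    have h3 := Submodule.add_mem _ h1 h2
    convert h3 using 1
    rw [map_mul, mul_pow]
    ring
  add_mem' := by
    rintro x y ⟨hx, hx'⟩ ⟨hy, hy'⟩
    refine ⟨U.add_mem hx hy, fun p => ?_⟩
    obtain ⟨ℓ, n, hℓ, hq, hmem⟩ := residueCard_eq p
    obtain ⟨r, hr⟩ := exists_add_pow_prime_pow_eq hℓ (⟨x, hx⟩ : U) (⟨y, hy⟩ : U) n
    have hr' : (x + y) ^ residueCard p
        = x ^ residueCard p + y ^ residueCard p + ℓ * x * y * r := by
      rw [hq]
      simpa using congrArg (Subtype.val) hr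
    have h3 : (ℓ : R) • (x * y * (r : NonzeroIdeal R → A)) ∈ p.asIdeal • U.toSubmodule :=
      Submodule.smul_mem_smul hmem (U.mul_mem (U.mul_mem hx hy) r.2)
    have h4 := Submodule.sub_mem _ (Submodule.add_mem _ (hx' p) (hy' p)) h3
    convert h4 using 1
    rw [map_add, hr', Algebra.smul_def, map_natCast]
    ring
  algebraMap_mem' := by
    intro r
    refine ⟨U.algebraMap_mem r, fun p => ?_⟩
    have h := Submodule.smul_mem_smul (sub_pow_residueCard_mem p r)
      (show (1 : NonzeroIdeal R → A) ∈ U.toSubmodule from U.one_mem)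
    convert h using 1
    rw [AlgHom.commutes, sub_smul, Algebra.algebraMap_eq_smul_one, smul_pow, one_pow]

variable (R A)

/-- The subalgebras `U_n(A)` of `A^{I_K}`. -/
def wittU : ℕ → Subalgebra R (NonzeroIdeal R → A)
  | 0 => ⊤
  | n + 1 => wittStep (wittU n)

/-- The ring `W_R(A) = ⋂ₙ U_n(A)` of Witt vectors with coefficients in the (flat) `R`-algebra
`A`, as an `R`-subalgebra of `A^{I_K}`. -/
def witt : Subalgebra R (NonzeroIdeal R → A) := ⨅ n, wittU R A n

variable {R A}

lemma mem_witt {ξ : NonzeroIdeal R → A} : ξ ∈ witt R A ↔ ∀ n, ξ ∈ wittU R A n := by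
  simp [witt, Algebra.mem_iInf]

lemma shift_prime_mem (p : HeightOneSpectrum R) {ξ : NonzeroIdeal R → A} (h : ξ ∈ witt R A) :
    shift A (primeIdeal p) ξ ∈ witt R A := by
  rw [mem_witt] at h ⊢
  intro n
  obtain ⟨h0, h1⟩ := h (n + 1)
  have := (wittU R A n).add_mem (smul_toSubmodule_le _ _ (h1 p))
    ((wittU R A n).pow_mem h0 (residueCard p))
  simpa using this

lemma shift_mem (a : NonzeroIdeal R) {ξ : NonzeroIdeal R → A} (h : ξ ∈ witt R A) :
    shift A a ξ ∈ witt R A := by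
  obtain ⟨a, ha⟩ := a
  suffices H : ∀ (ha : a ∈ (Ideal R)⁰) (ξ : NonzeroIdeal R → A), ξ ∈ witt R A →
      shift A ⟨a, ha⟩ ξ ∈ witt R A from H ha ξ h
  clear h ha ξ
  refine UniqueFactorizationMonoid.induction_on_prime a ?_ ?_ ?_
  · intro ha
    exact absurd rfl (nonZeroDivisors.ne_zero ha)
  · intro x hx ha ξ h
    have : (⟨x, ha⟩ : NonzeroIdeal R) = 1 := Subtype.ext (Ideal.isUnit_iff.mp hx |>.trans Ideal.one_eq_top.symm)
    rw [this, shift_one]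
    exact h
  · intro b q hb hq ih hqb ξ h
    let p : HeightOneSpectrum R := ⟨q, Ideal.isPrime_of_prime hq, hq.ne_zero⟩
    have : (⟨q * b, hqb⟩ : NonzeroIdeal R)
        = primeIdeal p * ⟨b, mem_nonZeroDivisors_of_ne_zero hb⟩ := rfl
    rw [this, shift_mul]
    exact shift_prime_mem p (ih _ ξ h)

/-- The operator `ψ_𝔞` on `W_R(A)`. By `shift_mul` it is the composite of the Frobenius lifts
`ψ_𝔭` over the prime factors `𝔭` of `𝔞`, with multiplicity. -/
def psi (a : NonzeroIdeal R) : witt R A →ₐ[R] witt R A :=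
  ((shift A a).comp (witt R A).val).codRestrict (witt R A) fun ξ => shift_mem a ξ.2

/-- The set of coefficient values `{ξ_𝔞 | 𝔞 ∈ I_K}` of a Witt vector. -/
def coeffs (ξ : witt R A) : Set A := Set.range fun a : NonzeroIdeal R => ξ.1 a

/-- The orbit `{ψ_𝔞 ξ | 𝔞 ∈ I_K}` of a Witt vector. -/
def orbit (ξ : witt R A) : Set (witt R A) := Set.range fun a : NonzeroIdeal R => psi a ξ

end Witt

/-! ### Automata -/

/-- A deterministic automaton with output, over the (arbitrary) input alphabet `Δ`, with output
alphabet `O` and state set `S`. It is a DFAO when `S` is finite. -/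
structure DFAO (Δ O S : Type*) where
  /-- transition function -/
  step : S → Δ → S
  /-- initial state -/
  start : S
  /-- output function -/
  output : S → O

/-- The output on a finite word, read from left to right. -/
def DFAO.eval {Δ O S : Type*} (M : DFAO Δ O S) (u : List Δ) : O :=
  M.output (u.foldl M.step M.start)

/-- A Witt vector `ξ` is automatic if some DFAO with finite state set, over the alphabet of nonzero
primes and with outputs in `A`, outputs `ξ_{𝔭₁⋯𝔭ᵣ}` on every finite word `𝔭₁ ⋯ 𝔭ᵣ`.
(Finite state sets may be taken in `Type` without loss of generality.) -/
def IsAutomatic {R : Type*} [CommRing R] [IsDedekindDomain R] [Ring.HasFiniteQuotients R]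
    {A : Type*} [CommRing A] [Algebra R A] (ξ : witt R A) : Prop :=
  ∃ (S : Type) (_ : Finite S) (M : DFAO (HeightOneSpectrum R) A S),
    ∀ u : List (HeightOneSpectrum R), ξ.1 (u.map primeIdeal).prod = M.eval u

end ArithChristol

end

open scoped Pointwise

namespace ArithChristol

/-! ### Finiteness of finitely generated commutative monoids of a special kind -/

section Monoid

variable {M : Type*} [CommMonoid M]

/-! Finiteness of the value set `C` is the hub. Integrality is tested coordinatewise: a monic
polynomial has finitely many roots in a domain, and conversely one multiplies monic polynomials
killing the values. A finite orbit serves as the state set of an automaton, whose outputs exhaust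
the values. The substantial step is from finite `C` to finite orbit. If `𝔭` divides no difference of
distinct values, then `ξ_{𝔭𝔞} ≡ ξ_𝔞^q` mod `𝔭` determines `ξ_{𝔭𝔞}` from `ξ_𝔞`, so `ψ_𝔭` acts through
a self-map of `C`, and there are finitely many of these. For the finitely many other primes, `ψ_𝔭`
is eventually periodic modulo every power of `𝔭` (`exists_periodic_mod_pow`); a high enough power
separates the elements of `C`, so the periodicity is exact (`exists_pow_add_eq`). As `I_K` is
commutative, `finite_range_translates` combines both kinds of primes. -/

lemma finite_powers_of_pow_add_eq {x : M} {N T : ℕ} (hT : 0 < T) (h : x ^ (N + T) = x ^ N) :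
    (Submonoid.powers x : Set M).Finite := by
  refine ((Finset.range (N + T)).finite_toSet.image (fun n => x ^ n)).subset ?_
  rintro _ ⟨n, rfl⟩
  induction n using Nat.strong_induction_on with
  | _ n ih =>
    by_cases hn : n < N + T
    · exact ⟨n, by simpa using hn, rfl⟩
    · obtain ⟨k, rfl⟩ := Nat.exists_eq_add_of_le (not_lt.mp hn)
      have e : x ^ (N + T + k) = x ^ (N + k) := by rw [pow_add, h, pow_add]
      simpa [e] using ih (N + k) (by omega)

lemma finite_closure_of_finite_powers {B : Set M} (hB : B.Finite)
    (h : ∀ x ∈ B, (Submonoid.powers x : Set M).Finite) :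
    (Submonoid.closure B : Set M).Finite := by
  induction B, hB using Set.Finite.induction_on with
  | empty => simp
  | @insert x B _ _ ih =>
    rw [Set.insert_eq, Submonoid.closure_union, Submonoid.coe_sup,
      ← Submonoid.powers_eq_closure]
    exact (h x (by simp)).mul (ih fun y hy => h y (by simp [hy]))

variable {C : Type*}

/-- The congruence identifying elements with equal translates of `f`. -/
def translateCon (f : M → C) : Con M where
  r a b := ∀ c, f (a * c) = f (b * c)
  iseqv := ⟨fun _ _ => rfl, fun h c => (h c).symm, fun h h' c => (h c).trans (h' c)⟩
  mul' {a b c d} h h' e := by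
    rw [mul_assoc, h, mul_left_comm, h', mul_left_comm, mul_assoc]

/-- The elements translation by which acts on `f` through a transformation of the values. -/
def valuewise (f : M → C) : Submonoid M where
  carrier := {g | ∃ φ : C → C, ∀ a, f (g * a) = φ (f a)}
  one_mem' := ⟨id, by simp⟩
  mul_mem' := by
    rintro a b ⟨φ, hφ⟩ ⟨ψ, hψ⟩
    exact ⟨φ ∘ ψ, fun c => by rw [mul_assoc, hφ, hψ, Function.comp_apply]⟩

/-- The class of `g` is determined by its self-map `φ` of the finite set `C`. -/
lemma finite_map_valuewise [Finite C] (f : M → C) :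
    (((valuewise f).map (translateCon f).mk' : Submonoid _) : Set (translateCon f).Quotient).Finite := by
  have h (q : (valuewise f).map (translateCon f).mk') :
      ∃ (g : M) (φ : C → C), (translateCon f).mk' g = q.1 ∧ ∀ a, f (g * a) = φ (f a) := by
    obtain ⟨g, ⟨φ, hφ⟩, hg⟩ := q.2
    exact ⟨g, φ, hg, hφ⟩
  choose g φ hg hφ using h
  refine Finite.of_injective φ fun q r h => Subtype.ext ?_
  rw [← hg q, ← hg r]
  exact (Con.eq _).2 fun a => by rw [hφ, hφ, h]

/-- A function with finitely many values on a commutative monoid has finitely many translates if,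
for generators `P`, translation by all but finitely many of them acts through the values and each
of them acts in an eventually periodic way. -/
lemma finite_range_translates [Finite C] (f : M → C) {P : Set M}
    (hP : Submonoid.closure P = ⊤) (hfin : {p ∈ P | p ∉ valuewise f}.Finite)
    (hper : ∀ p ∈ P, ∃ N T, 0 < T ∧ ∀ a, f (p ^ (N + T) * a) = f (p ^ N * a)) :
    (Set.range fun a b => f (a * b)).Finite := by
  have key : Finite (translateCon f).Quotient := by
    rw [← Set.finite_univ_iff]
    have h1 : valuewise f ⊔ Submonoid.closure {p ∈ P | p ∉ valuewise f} = ⊤ := by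
      rw [eq_top_iff, ← hP, Submonoid.closure_le]
      intro p hp
      by_cases h : p ∈ valuewise f
      · exact Submonoid.mem_sup_left h
      · exact Submonoid.mem_sup_right (Submonoid.subset_closure ⟨hp, h⟩)
    have h2 := congrArg (Submonoid.map (translateCon f).mk') h1
    rw [Submonoid.map_sup, ← MonoidHom.mrange_eq_map, Con.mrange_mk', MonoidHom.map_mclosure] at h2
    rw [← Submonoid.coe_top, ← h2, Submonoid.coe_sup]
    -- The quotient is the product of two finite submonoids: the valuewise classes, and those
    -- generated by the finitely many exceptional generators.
    refine (finite_map_valuewise f).mul (finite_closure_of_finite_powers (hfin.image _) ?_)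
    rintro _ ⟨p, hp, rfl⟩
    obtain ⟨N, T, hT, h⟩ := hper p hp.1
    refine finite_powers_of_pow_add_eq hT ?_ (N := N)
    rw [← map_pow, ← map_pow]
    exact (Con.eq _).2 h
  refine (Set.finite_range fun (q : (translateCon f).Quotient) b =>
    Con.liftOn q (fun a => f (a * b)) fun _ _ h => h b).subset ?_
  rintro _ ⟨a, rfl⟩
  exact ⟨a, rfl⟩

end Monoid

/-- In the expansion of `x ^ q` around `y`, the linear term gains a factor from `q ∈ J`; the rest
lies in `J ^ (2 * m)`, and `2 * m ≥ m + 1`. -/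
lemma sub_pow_mem_pow_succ {A : Type*} [CommRing A] {J : Ideal A} {q m : ℕ} (hq : (q : A) ∈ J)
    (hm : m ≠ 0) {x y : A} (h : x - y ∈ J ^ m) : x ^ q - y ^ q ∈ J ^ (m + 1) := by
  obtain ⟨k, hk⟩ := Polynomial.powAddExpansion y (x - y) q
  rw [add_sub_cancel] at hk
  have e : x ^ q - y ^ q = (x - y) * (q * y ^ (q - 1)) + k * (x - y) ^ 2 := by
    rw [hk]; ring
  rw [e]
  refine add_mem ?_ (Ideal.mul_mem_left _ _ ?_)
  · rw [pow_succ]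
    exact Ideal.mul_mem_mul h (Ideal.mul_mem_right _ _ hq)
  · refine Ideal.pow_le_pow_right (n := m * 2) (by omega) ?_
    rw [pow_mul]
    exact Ideal.pow_mem_pow h 2

lemma exists_iterate_add_eq {α : Type*} [Finite α] (g : α → α) :
    ∃ N T, 0 < T ∧ ∀ x, g^[N + T] x = g^[N] x := by
  obtain ⟨m, n, hmn, h⟩ := Finite.exists_ne_map_eq_of_infinite fun n : ℕ => g^[n]
  wlog hlt : m < n generalizing m n
  · exact this n m hmn.symm h.symm (by omega)
  refine ⟨m, n - m, by omega, fun x => ?_⟩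
  rw [Nat.add_sub_cancel' hlt.le]
  exact congrFun h.symm x

/-! ### Periodicity modulo powers of a prime -/

section Witt

variable {R : Type*} [CommRing R] {A : Type*} [CommRing A] [Algebra R A]

lemma residueCard_mem [Ring.HasFiniteQuotients R] (p : HeightOneSpectrum R) : (residueCard p : R) ∈ p.asIdeal := by
  have : Finite (R ⧸ p.asIdeal) := Ring.HasFiniteQuotients.finiteQuotient p.ne_bot
  rw [← Ideal.Quotient.eq_zero_iff_mem, map_natCast, residueCard]
  let _ := Fintype.ofFinite (R ⧸ p.asIdeal)
  rw [Nat.card_eq_fintype_card]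
  exact Nat.cast_card_eq_zero _

lemma apply_mem_map_of_mem_smul {I : Ideal R} {U : Submodule R (NonzeroIdeal R → A)}
    {ζ : NonzeroIdeal R → A} (h : ζ ∈ I • U) (a : NonzeroIdeal R) :
    ζ a ∈ I.map (algebraMap R A) := by
  refine Submodule.smul_induction_on h (fun r hr η _ => ?_) fun _ _ hx hy => add_mem hx hy
  rw [Pi.smul_apply, Algebra.smul_def]
  exact Ideal.mul_mem_right _ _ (Ideal.mem_map_of_mem _ hr)

variable [IsDedekindDomain R] [Ring.HasFiniteQuotients R]

lemma apply_prime_mul_sub_pow_mem (p : HeightOneSpectrum R) {n : ℕ} {ξ : NonzeroIdeal R → A}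
    (hξ : ξ ∈ wittU R A (n + 1)) (a : NonzeroIdeal R) :
    ξ (primeIdeal p * a) - ξ a ^ residueCard p ∈ p.asIdeal.map (algebraMap R A) :=
  apply_mem_map_of_mem_smul (hξ.2 p) a

/-- Modulo a power of `𝔭`, iterates of the shift by `𝔭` are eventually periodic, with a period
independent of the power. -/
lemma exists_periodic_mod_pow (p : HeightOneSpectrum R)
    [Finite (A ⧸ p.asIdeal.map (algebraMap R A))] :
    ∃ T, 0 < T ∧ ∀ m, ∃ N k, ∀ ξ ∈ wittU R A k, ∀ a : NonzeroIdeal R,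
      ξ (primeIdeal p ^ (N + T) * a) - ξ (primeIdeal p ^ N * a) ∈
        p.asIdeal.map (algebraMap R A) ^ (m + 1) := by
  set J := p.asIdeal.map (algebraMap R A) with hJ
  obtain ⟨N₀, T, hT, hper⟩ :=
    exists_iterate_add_eq fun x : A ⧸ J => x ^ residueCard p
  refine ⟨T, hT, fun m => ?_⟩
  induction m with
  | zero =>
    refine ⟨N₀, 1, fun ξ hξ a => ?_⟩
    have key (n : ℕ) : Ideal.Quotient.mk J (ξ (primeIdeal p ^ n * a)) =
        (fun x : A ⧸ J => x ^ residueCard p)^[n] (Ideal.Quotient.mk J (ξ a)) := by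
      induction n with
      | zero => simp
      | succ n ih =>
        rw [Function.iterate_succ_apply', ← ih, ← map_pow, Ideal.Quotient.eq, pow_succ', mul_assoc]
        exact apply_prime_mul_sub_pow_mem p hξ _
    rw [zero_add, pow_one, ← Ideal.Quotient.eq, key, key, hper]
  | succ m ih =>
    obtain ⟨N, k, h⟩ := ih
    -- Write `ψ_𝔭 ξ = ξ ^ q + ζ` with `ζ ∈ 𝔭 U_k`. Both terms gain one power of `𝔭`: `ζ` from its
    -- factor in `𝔭`, `ξ ^ q` by `sub_pow_mem_pow_succ`. The shift costs one in `N` and leaves `T`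
    -- alone.
    refine ⟨N + 1, k + 1, fun ξ hξ a => ?_⟩
    have h1 (ζ : NonzeroIdeal R → A) (hζ : ζ ∈ p.asIdeal • (wittU R A k).toSubmodule) :
        ζ (primeIdeal p ^ (N + T) * a) - ζ (primeIdeal p ^ N * a) ∈ J ^ (m + 2) := by
      refine Submodule.smul_induction_on hζ (fun r hr η hη => ?_) fun x y hx hy => ?_
      · rw [Pi.smul_apply, Pi.smul_apply, ← smul_sub, Algebra.smul_def, pow_succ' J (m + 1)]
        exact Ideal.mul_mem_mul (Ideal.mem_map_of_mem _ hr) (h η hη a)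
      · convert add_mem hx hy using 1
        simp only [Pi.add_apply]
        ring
    have hq : (residueCard p : A) ∈ J := by
      simpa using Ideal.mem_map_of_mem (algebraMap R A) (residueCard_mem p)
    have h2 := add_mem (h1 _ (hξ.2 p))
      (sub_pow_mem_pow_succ hq m.succ_ne_zero (h ξ hξ.1 a))
    convert h2 using 1
    simp only [Pi.sub_apply, Pi.pow_apply, shift_apply, ← mul_assoc, ← pow_succ']
    rw [add_right_comm]
    ring

end Witt

/-! ### The equivalence -/

section Equivalence

variable {R : Type*} [CommRing R] [IsDedekindDomain R]

lemma closure_range_primeIdeal :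
    Submonoid.closure (Set.range (primeIdeal (R := R))) = ⊤ := by
  rw [eq_top_iff]
  rintro ⟨a, ha⟩ -
  induction a using UniqueFactorizationMonoid.induction_on_prime with
  | h₁ => exact absurd rfl (nonZeroDivisors.ne_zero ha)
  | h₂ x hx =>
    have : (⟨x, ha⟩ : NonzeroIdeal R) = 1 :=
      Subtype.ext (Ideal.isUnit_iff.mp hx |>.trans Ideal.one_eq_top.symm)
    rw [this]
    exact one_mem _
  | h₃ b q hb hq ih =>
    let p : HeightOneSpectrum R := ⟨q, Ideal.isPrime_of_prime hq, hq.ne_zero⟩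
    have : (⟨q * b, ha⟩ : NonzeroIdeal R)
        = primeIdeal p * ⟨b, mem_nonZeroDivisors_of_ne_zero hb⟩ := rfl
    rw [this]
    exact mul_mem (Submonoid.subset_closure ⟨p, rfl⟩) (ih _)

lemma exists_list_prod_eq (a : NonzeroIdeal R) :
    ∃ u : List (HeightOneSpectrum R), (u.map primeIdeal).prod = a := by
  have h : a ∈ Submonoid.closure (Set.range (primeIdeal (R := R))) := by
    simp [closure_range_primeIdeal]
  induction h using Submonoid.closure_induction with
  | mem _ hp =>
    obtain ⟨p, rfl⟩ := hp
    exact ⟨[p], by simp⟩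
  | one => exact ⟨[], rfl⟩
  | mul _ _ _ _ hx hy =>
    obtain ⟨u, rfl⟩ := hx
    obtain ⟨v, rfl⟩ := hy
    exact ⟨u ++ v, by simp⟩

/-- By integrality `(x)` meets `R` in a nonzero ideal. With `P` a prime over `𝔭`, `x ∈ 𝔭A ⊆ P`
forces `(x) ∩ R ⊆ P ∩ R = 𝔭`, so `𝔭` is one of its finitely many prime factors. -/
lemma finite_setOf_mem_map_asIdeal {A : Type*} [CommRing A] [IsDomain A] [Algebra R A]
    [Algebra.IsIntegral R A] [FaithfulSMul R A] {x : A} (hx : x ≠ 0) :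
    {p : HeightOneSpectrum R | x ∈ p.asIdeal.map (algebraMap R A)}.Finite := by
  have hne : (Ideal.span {x}).comap (algebraMap R A) ≠ ⊥ :=
    Ideal.comap_ne_bot_of_integral_mem hx (Ideal.mem_span_singleton_self x)
      (Algebra.IsIntegral.isIntegral x)
  refine (Ideal.finite_factors hne).subset fun p hp => ?_
  rw [Set.mem_ofPred_eq, Ideal.dvd_iff_le]
  have := p.isMaximal
  obtain ⟨P, _, hP⟩ := Ideal.exists_maximal_ideal_liesOver_of_isIntegral (S := A) p.asIdeal
  rw [hP.over]
  refine Ideal.comap_mono ((Ideal.span_singleton_le_iff_mem _).2 ?_)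
  exact Ideal.map_le_iff_le_comap.2 hP.over.le hp

variable [Ring.HasFiniteQuotients R] {A : Type*} [CommRing A] [Algebra R A]

lemma isAutomatic_of_finite_orbit (ξ : witt R A) (h : (orbit ξ).Finite) : IsAutomatic ξ := by
  have : Finite (orbit ξ) := h
  obtain ⟨n, ⟨e⟩⟩ := Finite.exists_equiv_fin (orbit ξ)
  have hstep (s : orbit ξ) (p : HeightOneSpectrum R) : psi (primeIdeal p) s.1 ∈ orbit ξ := by
    obtain ⟨_, a, rfl⟩ := s
    exact ⟨primeIdeal p * a, Subtype.ext (shift_mul _ _ _)⟩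
  have hone : ξ ∈ orbit ξ := ⟨1, Subtype.ext (shift_one _)⟩
  let M : DFAO (HeightOneSpectrum R) A (Fin n) :=
    { step s p := e ⟨_, hstep (e.symm s) p⟩
      start := e ⟨ξ, hone⟩
      output s := (e.symm s).1.1 1 }
  refine ⟨Fin n, inferInstance, M, fun u => ?_⟩
  -- Stated for every initial state, so that the induction on the word can move the state.
  have key (u : List (HeightOneSpectrum R)) (s : Fin n) :
      (e.symm s).1.1 (u.map primeIdeal).prod = M.output (u.foldl M.step s) := by
    induction u generalizing s with
    | nil => rfl
    | cons p u ih =>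
      rw [List.foldl_cons, ← ih, List.map_cons, List.prod_cons]
      simp only [M, Equiv.symm_apply_apply]
      rfl
  simpa [M, DFAO.eval] using key u M.start

lemma finite_coeffs_of_isAutomatic (ξ : witt R A) (h : IsAutomatic ξ) : (coeffs ξ).Finite := by
  obtain ⟨S, _, M, hM⟩ := h
  refine (Set.finite_range M.output).subset ?_
  rintro _ ⟨a, rfl⟩
  obtain ⟨u, rfl⟩ := exists_list_prod_eq a
  exact ⟨_, (hM u).symm⟩

lemma finite_coeffs_of_isIntegral [IsDomain A] (ξ : witt R A) (h : IsIntegral R ξ) :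
    (coeffs ξ).Finite := by
  obtain ⟨f, hf, h0⟩ := h
  refine ((f.map (algebraMap R A)).rootSet_finite A).subset ?_
  rintro _ ⟨a, rfl⟩
  rw [Polynomial.mem_rootSet_of_ne (hf.map _).ne_zero, Polynomial.aeval_map_algebraMap]
  let φ : witt R A →ₐ[R] A := (Pi.evalAlgHom R _ a).comp (witt R A).val
  change Polynomial.aeval (φ ξ) f = 0
  rw [Polynomial.aeval_algHom_apply, Polynomial.aeval_def, h0, map_zero]

lemma isIntegral_of_finite_coeffs [Algebra.IsIntegral R A] (ξ : witt R A)
    (h : (coeffs ξ).Finite) : IsIntegral R ξ := by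
  choose f hf h0 using fun c : A => Algebra.IsIntegral.isIntegral (R := R) c
  refine ⟨∏ c ∈ h.toFinset, f c, Polynomial.monic_prod_of_monic _ _ fun c _ => hf c, ?_⟩
  refine Subtype.ext (funext fun a => ?_)
  let φ : witt R A →ₐ[R] A := (Pi.evalAlgHom R _ a).comp (witt R A).val
  change φ (Polynomial.aeval ξ _) = 0
  rw [← Polynomial.aeval_algHom_apply, map_prod]
  exact Finset.prod_eq_zero (i := φ ξ) (by simpa using ⟨a, rfl⟩) (h0 _)

variable [IsDomain A] [Ring.HasFiniteQuotients A] [Algebra.IsIntegral R A] [FaithfulSMul R A]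

lemma exists_pow_add_eq (ξ : witt R A) (h : (coeffs ξ).Finite) (p : HeightOneSpectrum R) :
    ∃ N T, 0 < T ∧ ∀ a, ξ.1 (primeIdeal p ^ (N + T) * a) = ξ.1 (primeIdeal p ^ N * a) := by
  set J := p.asIdeal.map (algebraMap R A) with hJ
  have hbot : J ≠ ⊥ := by
    rw [hJ, Ne, Ideal.map_eq_bot_iff_of_injective (FaithfulSMul.algebraMap_injective R A)]
    exact p.ne_bot
  have htop : J ≠ ⊤ := by
    rw [hJ, Ne, Ideal.map_eq_top_iff _ (FaithfulSMul.algebraMap_injective R A)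
      Algebra.IsIntegral.isIntegral]
    exact p.isPrime.ne_top
  have : Finite (A ⧸ J) := Ring.HasFiniteQuotients.finiteQuotient hbot
  -- Krull's intersection theorem.
  have hkrull : ∀ d : A, d ≠ 0 → ∃ m, d ∉ J ^ m := fun d hd => by
    by_contra! hall
    have : d ∈ ⨅ m, J ^ m := by simpa [Ideal.mem_iInf] using hall
    rw [Ideal.iInf_pow_eq_bot_of_isDomain J htop] at this
    exact hd this
  choose! μ hμ using hkrull
  -- `J ^ m` contains no nonzero difference of two values. Equal pairs contribute the arbitrary `μ
  -- 0`, which can only enlarge the bound.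
  obtain ⟨m, hm⟩ := ((h.prod h).image fun c => μ (c.1 - c.2)).bddAbove
  obtain ⟨T, hT, hper⟩ := exists_periodic_mod_pow (A := A) p
  obtain ⟨N, k, hN⟩ := hper m
  refine ⟨N, T, hT, fun a => ?_⟩
  by_contra hne
  refine hμ _ (sub_ne_zero.2 hne) (Ideal.pow_le_pow_right ?_ (hN ξ.1 (mem_witt.1 ξ.2 k) a))
  exact (hm ⟨(_, _), ⟨⟨_, rfl⟩, ⟨_, rfl⟩⟩, rfl⟩).trans m.le_succ

lemma finite_orbit_of_finite_coeffs (ξ : witt R A) (h : (coeffs ξ).Finite) :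
    (orbit ξ).Finite := by
  have : Finite (coeffs ξ) := h
  let f : NonzeroIdeal R → coeffs ξ := fun a => ⟨ξ.1 a, a, rfl⟩
  have hfin : {p : HeightOneSpectrum R | primeIdeal p ∉ valuewise f}.Finite := by
    -- The bad primes: those for which two distinct values are congruent modulo `𝔭A`.
    have hbad : (⋃ c ∈ (coeffs ξ ×ˢ coeffs ξ) ∩ {c | c.1 - c.2 ≠ 0},
        {p : HeightOneSpectrum R | c.1 - c.2 ∈ p.asIdeal.map (algebraMap R A)}).Finite :=
      ((h.prod h).inter_of_left _).biUnion fun c hc => finite_setOf_mem_map_asIdeal hc.2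
    refine hbad.subset fun p hp => ?_
    by_contra hgood
    refine hp ?_
    have hft : Function.FactorsThrough (fun a => f (primeIdeal p * a)) f := by
      intro a b hab
      replace hab : ξ.1 a = ξ.1 b := congrArg Subtype.val hab
      refine Subtype.ext ?_
      by_contra hne
      refine hgood (Set.mem_biUnion (x := (ξ.1 (primeIdeal p * a), ξ.1 (primeIdeal p * b)))
        ⟨⟨⟨_, rfl⟩, ⟨_, rfl⟩⟩, sub_ne_zero.2 hne⟩ ?_)
      have hU := mem_witt.1 ξ.2 1
      have := sub_mem (apply_prime_mul_sub_pow_mem p hU a) (apply_prime_mul_sub_pow_mem p hU b)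
      rwa [hab, sub_sub_sub_cancel_right] at this
    have : Nonempty (coeffs ξ) := ⟨f 1⟩
    obtain ⟨φ, hφ⟩ := (Function.factorsThrough_iff _).1 hft
    exact ⟨φ, congrFun hφ⟩
  have := finite_range_translates f closure_range_primeIdeal
    ((hfin.image primeIdeal).subset ?_) ?_
  · refine Set.Finite.of_finite_image (f := fun (η : witt R A) => η.1) (Set.Finite.subset
      (this.image fun g b => (g b : A)) ?_) Subtype.val_injective.injOn
    rintro _ ⟨_, ⟨a, rfl⟩, rfl⟩
    exact ⟨_, ⟨a, rfl⟩, rfl⟩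
  · rintro _ ⟨⟨p, rfl⟩, hp⟩
    exact ⟨p, hp, rfl⟩
  · rintro _ ⟨p, rfl⟩
    obtain ⟨N, T, hT, hper⟩ := exists_pow_add_eq ξ h p
    exact ⟨N, T, hT, fun a => Subtype.ext (hper a)⟩

end Equivalence

end ArithChristol

theorem mainTheorem1 (K L : Type*) [Field K] [NumberField K] [Field L] [NumberField L]
    [Algebra K L] (ξ : ArithChristol.witt (𝓞 K) (𝓞 L)) :
    List.TFAE [
      IsIntegral (𝓞 K) ξ,
      (ArithChristol.coeffs ξ).Finite,
      (ArithChristol.orbit ξ).Finite,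
      ArithChristol.IsAutomatic ξ] := by
  tfae_have 1 → 2 := ArithChristol.finite_coeffs_of_isIntegral ξ
  tfae_have 2 → 1 := ArithChristol.isIntegral_of_finite_coeffs ξ
  tfae_have 2 → 3 := ArithChristol.finite_orbit_of_finite_coeffs ξ
  tfae_have 3 → 4 := ArithChristol.isAutomatic_of_finite_orbit ξ
  tfae_have 4 → 2 := ArithChristol.finite_coeffs_of_isAutomatic ξ
  tfae_finish
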